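/- Let $\chi:[0,+\infty)\to\mathbb{R}$ be a compactly supported infinitely smooth function with $\chi=1$ in a neighbourhood of zero. For $s\in(-3,+\infty)$ and $\alpha,\beta\in\{1,2,3\}$ define $f^{(s)}_{\alpha\beta}:\mathbb{R}^3\to\mathbb{R}$ by $f^{(s)}_{\alpha\beta}(0)=0$ and $$f^{(s)}_{\alpha\beta}(y)=\frac{y_\alpha y_\beta-\frac13\delta_{\alpha\beta}|y|^2}{|y|^{2-s}}\,\chi(|y|)\quad\text{for } y\neq 0,$$ which is integrable, and let $$\hat f^{(s)}_{\alpha\beta}(\xi)=\int_{\mathbb{R}^3}e^{-iy\cdot\xi}f^{(s)}_{\alpha\beta}(y)\,dy .$$ Put $c(0)=-6\pi^2$, $c(-2)=-\pi^2$ and $$c(s)=-\frac{4\pi\,\Gamma(s+4)}{s(s+2)}\sin\frac{\pi s}{2}\quad\text{for } s\in(-3,+\infty)\setminus\{0,-2\}.$$ Then $$\hat f^{(s)}_{\alpha\beta}(\xi)=c(s)\,\frac{\xi_\alpha\xi_\beta-\frac13\delta_{\alpha\beta}|\xi|^2}{|\xi|^{5+s}}+O(|\xi|^{-\infty})\quad\text{as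 }|\xi|\to+\infty,$$ where the remainder, together with its partial derivatives in $\xi$ of any order, is uniform in $s$ over any closed bounded interval $[a,b]\subset(-3,+\infty)$. That is, denoting by $r^{(s)}_{\alpha\beta}(\xi)$ the difference of the left-hand side and the first term on the right-hand side, $r^{(s)}_{\alpha\beta}$ is infinitely differentiable on $\mathbb{R}^3\setminus\{0\}$, and for every $[a,b]\subset(-3,+\infty)$ and all integers $k,N\ge0$ there exist $C$ and $R>0$, independent of $s$ and $\xi$, such that every partial derivative of order $k$ of $r^{(s)}_{\alpha\beta}$ is bounded in absolute value by $C|\xi|^{-N}$ for all $s\in[a,b]$ and all $|\xi|\ge R$. -/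

import Mathlib

open scoped ContDiff

noncomputable section

/-- Cut-off functions `χ : [0, +∞) → ℝ`: infinitely smooth up to the endpoint, compactly supported,
and equal to `1` in a neighbourhood of zero. Only the values of `χ` on `[0, +∞)` are constrained
(and only these will be used). -/
structure IsRadialCutoff (χ : ℝ → ℝ) : Prop where
  smooth : ContDiffOn ℝ ∞ χ (Set.Ici 0)
  compact_support : ∃ R : ℝ, ∀ r : ℝ, 0 ≤ r → R ≤ r → χ r = 0
  eq_one_near_zero : ∃ ε : ℝ, 0 < ε ∧ ∀ r : ℝ, 0 ≤ r → r < ε → χ r = 1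

/-- The trace-free quadratic form `y_α y_β - δ_{αβ} |y|² / 3` on Euclidean space `ℝ³`. -/
def tracelessQuad (α β : Fin 3) (y : EuclideanSpace ℝ (Fin 3)) : ℝ :=
  y α * y β - (1 / 3) * (if α = β then 1 else 0) * ‖y‖ ^ 2

/-- The cut-off kernel `f^(s)_{αβ}`, extended by zero to the origin. -/
def refKernel (χ : ℝ → ℝ) (s : ℝ) (α β : Fin 3) (y : EuclideanSpace ℝ (Fin 3)) : ℝ :=
  open Classical in
  if y = 0 then 0 else tracelessQuad α β y / ‖y‖ ^ (2 - s) * χ ‖y‖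

/-- The Fourier transform `∫ exp(-i y·ξ) f^(s)_{αβ}(y) dy`, without factors of `2π`. -/
def refKernelHat (χ : ℝ → ℝ) (s : ℝ) (α β : Fin 3) (ξ : EuclideanSpace ℝ (Fin 3)) : ℂ :=
  ∫ y : EuclideanSpace ℝ (Fin 3),
    Complex.exp (-Complex.I * ((inner ℝ y ξ : ℝ) : ℂ)) * ((refKernel χ s α β y : ℝ) : ℂ)

/-- The constant `c(s)`. -/
def refConst (s : ℝ) : ℝ :=
  open Classical in
  if s = 0 then -6 * Real.pi ^ 2
  else if s = -2 then -Real.pi ^ 2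
  else -(4 * Real.pi * Real.Gamma (s + 4) / (s * (s + 2))) * Real.sin (Real.pi * s / 2)

/-- The remainder: the Fourier transform minus the leading term
`c(s) (ξ_α ξ_β - δ_{αβ} |ξ|² / 3) / |ξ|^(5+s)`. -/
def refRemainder (χ : ℝ → ℝ) (s : ℝ) (α β : Fin 3) (ξ : EuclideanSpace ℝ (Fin 3)) : ℂ :=
  refKernelHat χ s α β ξ - ((refConst s * (tracelessQuad α β ξ / ‖ξ‖ ^ (5 + s)) : ℝ) : ℂ)

end

/-!
For trace-free `A` the polynomial `⟪A y, y⟫` is a solid harmonic, so the Fourier transform maps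
`⟪A y, y⟫ exp(-t|y|²)` to a multiple of `t^(-d/2-2) ⟪A ξ, ξ⟫ exp(-|ξ|²/(4t))`. Up to a Schwartz
function that stays bounded in `𝓢` for bounded `s`, the cut-off power `|y|^(s-2) χ(|y|)` equals
`Γ(1 - s/2)⁻¹ ∫_1^∞ t^(-s/2) exp(-t|y|²) dt`, a superposition of Gaussians. Since `1/Γ` is entire,
this is uniform in `s`, and the singularities of `c(s)` at `s = 0` and `s = -2` are removable.
In the Fourier transform of this superposition the substitution `t ↦ 1/t` produces an integral over
`(0, 1)`. Completing it to Euler's integral over `(0, ∞)` gives the homogeneous leading term, and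
the missing integral over `(1, ∞)` decays exponentially in `ξ`.
-/

open MeasureTheory ProbabilityTheory Set Filter Topology
open scoped SchwartzMap FourierTransform InnerProductSpace

/-- The Laplace-type integral `∫_I t^σ exp(-t x) dt`. For `I = (0, 1)` and `I = (1, ∞)` and
`x > 0` it is `x^(-σ-1)` times a lower or upper incomplete Gamma function. -/
noncomputable def laplaceOn (I : Set ℝ) (σ x : ℝ) : ℝ :=
  ∫ t in I, t ^ σ * Real.exp (-(t * x))

section LaplaceOn

variable {I U : Set ℝ} {σ x : ℝ}

/-- The measure `t^σ dt` on `I`, in terms of which `laplaceOn I σ` is a moment generating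
function. -/
noncomputable def rpowMeasure (I : Set ℝ) (σ : ℝ) : Measure ℝ :=
  (volume.restrict I).withDensity fun t => ENNReal.ofReal (t ^ σ)

theorem integral_rpowMeasure (hI : MeasurableSet I) (hI0 : I ⊆ Ioi 0) (g : ℝ → ℝ) :
    ∫ t, g t ∂rpowMeasure I σ = ∫ t in I, t ^ σ * g t := by
  rw [rpowMeasure, integral_withDensity_eq_integral_toReal_smul (by fun_prop) (by simp)]
  refine setIntegral_congr_fun hI fun t ht => ?_
  rw [ENNReal.toReal_ofReal (Real.rpow_nonneg (hI0 ht).le σ), smul_eq_mul]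

theorem integrable_rpowMeasure_iff (hI : MeasurableSet I) (hI0 : I ⊆ Ioi 0) {g : ℝ → ℝ} :
    Integrable g (rpowMeasure I σ) ↔ IntegrableOn (fun t => t ^ σ * g t) I := by
  rw [rpowMeasure, integrable_withDensity_iff_integrable_smul' (by fun_prop) (by simp)]
  refine integrableOn_congr_fun (fun t ht => ?_) hI
  rw [ENNReal.toReal_ofReal (Real.rpow_nonneg (hI0 ht).le σ), smul_eq_mul]

theorem laplaceOn_eq_mgf (hI : MeasurableSet I) (hI0 : I ⊆ Ioi 0) (σ : ℝ) :
    laplaceOn I σ = mgf Neg.neg (rpowMeasure I σ) := by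
  ext x
  rw [mgf, integral_rpowMeasure hI hI0]
  simp only [laplaceOn, mul_comm x, neg_mul]

theorem mem_interior_integrableExpSet_rpowMeasure (hI : MeasurableSet I) (hI0 : I ⊆ Ioi 0)
    (hU : IsOpen U) (h : ∀ x ∈ U, IntegrableOn (fun t => t ^ σ * Real.exp (-(t * x))) I)
    (hx : x ∈ U) : x ∈ interior (integrableExpSet Neg.neg (rpowMeasure I σ)) := by
  refine interior_maximal (fun y hy => ?_) hU hx
  refine (integrable_rpowMeasure_iff hI hI0).2 ?_
  simpa only [mul_comm y, neg_mul] using h y hy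

theorem contDiffOn_laplaceOn (hI : MeasurableSet I) (hI0 : I ⊆ Ioi 0) (hU : IsOpen U)
    (h : ∀ x ∈ U, IntegrableOn (fun t => t ^ σ * Real.exp (-(t * x))) I) :
    ContDiffOn ℝ ∞ (laplaceOn I σ) U := fun x hx => by
  rw [laplaceOn_eq_mgf hI hI0]
  exact (analyticAt_mgf
    (mem_interior_integrableExpSet_rpowMeasure hI hI0 hU h hx)).contDiffAt.contDiffWithinAt

theorem iteratedDeriv_laplaceOn (hI : MeasurableSet I) (hI0 : I ⊆ Ioi 0) (hU : IsOpen U)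
    (h : ∀ x ∈ U, IntegrableOn (fun t => t ^ σ * Real.exp (-(t * x))) I) (hx : x ∈ U) (n : ℕ) :
    iteratedDeriv n (laplaceOn I σ) x = (-1) ^ n * laplaceOn I (σ + n) x := by
  rw [laplaceOn_eq_mgf hI hI0,
    iteratedDeriv_mgf (mem_interior_integrableExpSet_rpowMeasure hI hI0 hU h hx),
    integral_rpowMeasure hI hI0, laplaceOn, ← integral_const_mul]
  refine setIntegral_congr_fun hI fun t ht => ?_
  simp only [Real.rpow_add_natCast (hI0 ht).ne', neg_pow t, mul_comm x, neg_mul]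
  ring

theorem laplaceOn_nonneg (hI : MeasurableSet I) (hI0 : I ⊆ Ioi 0) (σ x : ℝ) :
    0 ≤ laplaceOn I σ x :=
  setIntegral_nonneg hI fun _ ht =>
    mul_nonneg (Real.rpow_nonneg (hI0 ht).le σ) (Real.exp_pos _).le

theorem abs_iteratedDeriv_laplaceOn (hI : MeasurableSet I) (hI0 : I ⊆ Ioi 0) (hU : IsOpen U)
    (h : ∀ x ∈ U, IntegrableOn (fun t => t ^ σ * Real.exp (-(t * x))) I) (hx : x ∈ U) (n : ℕ) :
    |iteratedDeriv n (laplaceOn I σ) x| = laplaceOn I (σ + n) x := by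
  rw [iteratedDeriv_laplaceOn hI hI0 hU h hx, abs_mul, abs_pow, abs_neg, abs_one, one_pow, one_mul,
    abs_of_nonneg (laplaceOn_nonneg hI hI0 _ _)]

theorem integrableOn_Ioi_one_rpow_mul_exp (σ : ℝ) (hx : 0 < x) :
    IntegrableOn (fun t : ℝ => t ^ σ * Real.exp (-(t * x))) (Ioi 1) := by
  have hdom : IntegrableOn (fun t : ℝ => t ^ max σ 0 * Real.exp (-x * t)) (Ioi 1) := by
    have h := integrableOn_rpow_mul_exp_neg_mul_rpow (s := max σ 0)
      (neg_one_lt_zero.trans_le (le_max_right _ _)) one_pos hx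
    simp only [Real.rpow_one] at h
    exact h.mono_set (Ioi_subset_Ioi zero_le_one)
  refine hdom.mono' (by fun_prop) ((ae_restrict_iff' measurableSet_Ioi).2
    (Eventually.of_forall fun t (ht : 1 < t) => ?_))
  rw [Real.norm_of_nonneg (by positivity), neg_mul, mul_comm x t]
  gcongr
  · exact ht.le
  · exact le_max_left _ _

theorem integrableOn_Ioo_rpow_mul_exp (hσ : -1 < σ) (x : ℝ) :
    IntegrableOn (fun t : ℝ => t ^ σ * Real.exp (-(t * x))) (Ioo 0 1) :=
  ((intervalIntegral.integrableOn_Ioo_rpow_iff zero_lt_one).2 hσ).mul_continuousOn_of_subset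
    (by fun_prop) measurableSet_Ioo isCompact_Icc Ioo_subset_Icc_self

theorem contDiffOn_laplaceOn_Ioi_one (σ : ℝ) : ContDiffOn ℝ ∞ (laplaceOn (Ioi 1) σ) (Ioi 0) :=
  contDiffOn_laplaceOn measurableSet_Ioi (Ioi_subset_Ioi zero_le_one) isOpen_Ioi
    fun _ => integrableOn_Ioi_one_rpow_mul_exp σ

theorem contDiff_laplaceOn_Ioo (hσ : -1 < σ) : ContDiff ℝ ∞ (laplaceOn (Ioo 0 1) σ) :=
  contDiffOn_univ.1 <| contDiffOn_laplaceOn measurableSet_Ioo Ioo_subset_Ioi_self isOpen_univ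
    fun x _ => integrableOn_Ioo_rpow_mul_exp hσ x

theorem pow_mul_exp_neg_half_le (k : ℕ) (hx : 0 ≤ x) :
    x ^ k * Real.exp (-(x / 2)) ≤ 2 ^ k * k.factorial := by
  have h := Real.pow_div_factorial_le_exp (x / 2) (by positivity) k
  rw [Real.exp_neg, ← div_eq_mul_inv, div_le_iff₀ (Real.exp_pos _)]
  rwa [div_le_iff₀ (by positivity), div_pow, div_le_iff₀' (by positivity),
    mul_comm (Real.exp _), ← mul_assoc] at h

theorem pow_mul_laplaceOn_Ioi_one_le {B δ : ℝ} (hδ : 0 < δ) (hσ : σ ≤ B) (hx : δ ≤ x) (k : ℕ) :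
    x ^ k * laplaceOn (Ioi 1) σ x ≤ 2 ^ k * k.factorial * laplaceOn (Ioi 1) B (δ / 2) := by
  have hx0 : 0 < x := hδ.trans_le hx
  simp only [laplaceOn, ← integral_const_mul]
  refine setIntegral_mono_on ((integrableOn_Ioi_one_rpow_mul_exp _ hx0).const_mul _)
    ((integrableOn_Ioi_one_rpow_mul_exp _ (half_pos hδ)).const_mul _) measurableSet_Ioi
    fun t (ht : 1 < t) => ?_
  have hexp : Real.exp (-(t * x)) ≤ Real.exp (-(x / 2)) * Real.exp (-(t * (δ / 2))) := by
    rw [← Real.exp_add, Real.exp_le_exp]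
    nlinarith
  calc x ^ k * (t ^ σ * Real.exp (-(t * x)))
      ≤ x ^ k * (t ^ B * (Real.exp (-(x / 2)) * Real.exp (-(t * (δ / 2))))) := by
        gcongr
        exact ht.le
    _ = (x ^ k * Real.exp (-(x / 2))) * (t ^ B * Real.exp (-(t * (δ / 2)))) := by ring
    _ ≤ 2 ^ k * k.factorial * (t ^ B * Real.exp (-(t * (δ / 2)))) :=
        mul_le_mul_of_nonneg_right (pow_mul_exp_neg_half_le k hx0.le) (by positivity)

theorem laplaceOn_Ioo_le {A X : ℝ} (hA : -1 < A) (hσ : A ≤ σ) (hx : |x| ≤ X) :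
    laplaceOn (Ioo 0 1) σ x ≤ laplaceOn (Ioo 0 1) A (-X) := by
  refine setIntegral_mono_on (integrableOn_Ioo_rpow_mul_exp (hA.trans_le hσ) x)
    (integrableOn_Ioo_rpow_mul_exp hA _) measurableSet_Ioo fun t ⟨ht0, ht1⟩ => ?_
  refine mul_le_mul (Real.rpow_le_rpow_of_exponent_ge ht0 ht1.le hσ) (Real.exp_le_exp.2 ?_)
    (Real.exp_pos _).le (Real.rpow_nonneg ht0.le _)
  nlinarith [neg_abs_le x]

theorem laplaceOn_Ioo_add_laplaceOn_Ioi (hσ : -1 < σ) (hx : 0 < x) :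
    laplaceOn (Ioo 0 1) σ x + laplaceOn (Ioi 1) σ x = Real.Gamma (σ + 1) * x ^ (-σ - 1) := by
  have hEuler := Real.integral_rpow_mul_exp_neg_mul_Ioi (a := σ + 1) (by linarith) hx
  simp only [add_sub_cancel_right, mul_comm x] at hEuler
  rw [laplaceOn, laplaceOn, ← integral_Ioc_eq_integral_Ioo, ← setIntegral_union
    (Ioc_disjoint_Ioi le_rfl) measurableSet_Ioi
    (integrableOn_Ioc_iff_integrableOn_Ioo (by simp) |>.2 (integrableOn_Ioo_rpow_mul_exp hσ x))
    (integrableOn_Ioi_one_rpow_mul_exp σ hx), Ioc_union_Ioi_eq_Ioi zero_le_one, hEuler, one_div,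
    Real.inv_rpow hx.le, ← Real.rpow_neg hx.le, mul_comm, neg_add']

theorem mul_laplaceOn_Ioi_one (σ : ℝ) (hx : 0 < x) :
    x * laplaceOn (Ioi 1) σ x = Real.exp (-x) + σ * laplaceOn (Ioi 1) (σ - 1) x := by
  have hint : ∀ τ c : ℝ,
      IntegrableOn (fun t : ℝ => c * (t ^ τ * Real.exp (-(t * x)))) (Ioi 1) := fun τ c =>
    (integrableOn_Ioi_one_rpow_mul_exp τ hx).const_mul c
  have hderiv : ∀ t ∈ Ici (1 : ℝ), HasDerivAt (fun t : ℝ => t ^ σ * Real.exp (-(t * x)))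
      (σ * (t ^ (σ - 1) * Real.exp (-(t * x))) - x * (t ^ σ * Real.exp (-(t * x)))) t := by
    intro t ht
    have hexp := ((hasDerivAt_id t).mul_const x).fun_neg.exp
    refine ((Real.hasDerivAt_rpow_const (p := σ)
      (Or.inl (zero_lt_one.trans_le ht).ne')).fun_mul hexp).congr_deriv ?_
    simp only [id]
    ring
  have hlim : Tendsto (fun t : ℝ => t ^ σ * Real.exp (-(t * x))) atTop (𝓝 0) := by
    simpa only [neg_mul, mul_comm x] using tendsto_rpow_mul_exp_neg_mul_atTop_nhds_zero σ x hx
  have key := integral_Ioi_of_hasDerivAt_of_tendsto' hderiv ((hint (σ - 1) σ).sub (hint σ x)) hlim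
  rw [integral_sub (hint _ _) (hint _ _), integral_const_mul, integral_const_mul] at key
  simp only [Real.one_rpow, one_mul] at key
  unfold laplaceOn
  linarith

end LaplaceOn

section BoundedFamilies

open Bornology

variable {ι E F E' F' : Type*} [NormedAddCommGroup E] [NormedSpace ℝ E] [NormedAddCommGroup F]
  [NormedSpace ℝ F] [NormedAddCommGroup E'] [NormedSpace ℝ E'] [NormedAddCommGroup F']
  [NormedSpace ℝ F'] {Φ Ψ : ι → 𝓢(E, F)}

theorem isVonNBounded_range_schwartz_iff : IsVonNBounded ℝ (range Φ) ↔
    ∀ k n : ℕ, ∃ C, ∀ i, SchwartzMap.seminorm ℝ k n (Φ i) ≤ C := by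
  simp only [(schwartz_withSeminorms ℝ E F).isVonNBounded_iff_seminorm_bddAbove, Prod.forall,
    ← range_comp, bddAbove_def, forall_mem_range, SchwartzMap.schwartzSeminormFamily_apply,
    Function.comp_apply]

theorem isVonNBounded_range_clm_comp (T : 𝓢(E, F) →L[ℝ] 𝓢(E', F'))
    (hΦ : IsVonNBounded ℝ (range Φ)) : IsVonNBounded ℝ (range fun i => T (Φ i)) := by
  have h := hΦ.image T
  rwa [← range_comp] at h

theorem isVonNBounded_range_add (hΦ : IsVonNBounded ℝ (range Φ))
    (hΨ : IsVonNBounded ℝ (range Ψ)) : IsVonNBounded ℝ (range fun i => Φ i + Ψ i) :=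
  (hΦ.add hΨ).subset <| range_subset_iff.2 fun i =>
    add_mem_add (mem_range_self i) (mem_range_self i)

theorem isVonNBounded_range_smul {c : ι → ℝ} {M : ℝ} (hc : ∀ i, |c i| ≤ M)
    (hΦ : IsVonNBounded ℝ (range Φ)) : IsVonNBounded ℝ (range fun i => c i • Φ i) := by
  rw [isVonNBounded_range_schwartz_iff] at hΦ ⊢
  intro k n
  obtain ⟨C, hC⟩ := hΦ k n
  refine ⟨M * C, fun i => ?_⟩
  rw [map_smul_eq_mul, Real.norm_eq_abs]
  exact mul_le_mul (hc i) (hC i) (apply_nonneg _ _) ((abs_nonneg _).trans (hc i))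

theorem exists_schwartz_family_of_decay {f : ι → E → F} (hf : ∀ i, ContDiff ℝ ∞ (f i))
    (hdecay : ∀ k n : ℕ, ∃ C, ∀ i x, ‖x‖ ^ k * ‖iteratedFDeriv ℝ n (f i) x‖ ≤ C) :
    ∃ Φ : ι → 𝓢(E, F), IsVonNBounded ℝ (range Φ) ∧ ∀ i x, Φ i x = f i x := by
  refine ⟨fun i => ⟨f i, hf i, fun k n => (hdecay k n).imp fun _ hC => hC i⟩,
    isVonNBounded_range_schwartz_iff.2 fun k n => ?_, fun _ _ => rfl⟩
  obtain ⟨C, hC⟩ := hdecay k n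
  exact ⟨C, fun i => SchwartzMap.seminorm_le_bound ℝ k n _
    ((by positivity : (0 : ℝ) ≤ _).trans (hC i 0)) (hC i)⟩

variable {θ : E → ℝ} {g : E → F} {U : Set E}

theorem contDiff_smul_of_tsupport_subset (hθ : ContDiff ℝ ∞ θ) (hU : IsOpen U)
    (hsupp : tsupport θ ⊆ U) (hg : ContDiffOn ℝ ∞ g U) : ContDiff ℝ ∞ fun x => θ x • g x :=
  contMDiff_iff_contDiff.1 <| contMDiff_of_tsupport fun _ hx => contMDiffAt_iff_contDiffAt.2 <|
    hθ.contDiffAt.smul <| hg.contDiffAt <| hU.mem_nhds <| hsupp <| tsupport_smul_subset_left θ g hx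

theorem norm_iteratedFDeriv_smul_le_of_tsupport_subset (hθ : ContDiff ℝ ∞ θ) (hU : IsOpen U)
    (hsupp : tsupport θ ⊆ U) (hg : ContDiffOn ℝ ∞ g U) {C D : ℕ → ℝ} {k n : ℕ}
    (hC : ∀ n x, ‖iteratedFDeriv ℝ n θ x‖ ≤ C n)
    (hD : ∀ n, ∀ x ∈ tsupport θ, ‖x‖ ^ k * ‖iteratedFDeriv ℝ n g x‖ ≤ D n) (x : E) :
    ‖x‖ ^ k * ‖iteratedFDeriv ℝ n (fun y => θ y • g y) x‖ ≤
      ∑ i ∈ Finset.range (n + 1), (n.choose i : ℝ) * C i * |D (n - i)| := by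
  have hC0 : ∀ i, 0 ≤ C i := fun i => (norm_nonneg _).trans (hC i x)
  by_cases hx : x ∈ tsupport θ
  · have hLeibniz := norm_iteratedFDerivWithin_smul_le (n := n) hθ.contDiffOn hg hU.uniqueDiffOn
      (hsupp hx) (by exact_mod_cast le_top)
    simp only [iteratedFDerivWithin_of_isOpen _ hU (hsupp hx)] at hLeibniz
    refine (mul_le_mul_of_nonneg_left hLeibniz (by positivity)).trans ?_
    rw [Finset.mul_sum]
    refine Finset.sum_le_sum fun i _ => ?_
    calc ‖x‖ ^ k * ((n.choose i : ℝ) * ‖iteratedFDeriv ℝ i θ x‖ * ‖iteratedFDeriv ℝ (n - i) g x‖)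
        = (n.choose i : ℝ) * ‖iteratedFDeriv ℝ i θ x‖ *
          (‖x‖ ^ k * ‖iteratedFDeriv ℝ (n - i) g x‖) := by ring
      _ ≤ (n.choose i : ℝ) * C i * |D (n - i)| := by
        have := hC0 i
        gcongr
        · exact hC i x
        · exact (hD _ x hx).trans (le_abs_self _)
  · have hzero : iteratedFDeriv ℝ n (fun y => θ y • g y) x = 0 := by
      by_contra h
      exact hx (tsupport_smul_subset_left θ g (support_iteratedFDeriv_subset n h))
    rw [hzero, norm_zero, mul_zero]
    exact Finset.sum_nonneg fun i _ =>
      mul_nonneg (mul_nonneg (by positivity) (hC0 i)) (abs_nonneg _)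

theorem exists_schwartz_family_cutoff_smul (hθ : ContDiff ℝ ∞ θ)
    (hθ_bdd : ∀ n, ∃ C, ∀ x, ‖iteratedFDeriv ℝ n θ x‖ ≤ C) (hU : IsOpen U)
    (hsupp : tsupport θ ⊆ U) {G : ι → E → F} (hG : ∀ i, ContDiffOn ℝ ∞ (G i) U)
    (hdecay : ∀ k n : ℕ, ∃ C, ∀ i, ∀ x ∈ tsupport θ, ‖x‖ ^ k * ‖iteratedFDeriv ℝ n (G i) x‖ ≤ C) :
    ∃ Φ : ι → 𝓢(E, F), IsVonNBounded ℝ (range Φ) ∧ ∀ i x, Φ i x = θ x • G i x := by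
  refine exists_schwartz_family_of_decay
    (fun i => contDiff_smul_of_tsupport_subset hθ hU hsupp (hG i)) fun k n => ?_
  choose C hC using hθ_bdd
  choose D hD using hdecay k
  exact ⟨_, fun i => norm_iteratedFDeriv_smul_le_of_tsupport_subset hθ hU hsupp (hG i) hC
    fun n => hD n i⟩

end BoundedFamilies

section CutoffLaplace

open Bornology

variable {ι : Type*} {θ : ℝ → ℝ}

theorem exists_norm_iteratedFDeriv_le_of_eventually_const (hθ : ContDiff ℝ ∞ θ) {c d : ℝ}
    (hbot : ∀ᶠ x in atBot, θ x = c) (htop : ∀ᶠ x in atTop, θ x = d) (n : ℕ) :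
    ∃ C, ∀ x, ‖iteratedFDeriv ℝ n θ x‖ ≤ C := by
  obtain ⟨a, ha⟩ := eventually_atBot.1 hbot
  obtain ⟨b, hb⟩ := eventually_atTop.1 htop
  obtain ⟨C, hC⟩ := (isCompact_Icc (a := a) (b := b)).exists_bound_of_continuousOn
    (hθ.continuous_iteratedDeriv n (by exact_mod_cast le_top)).continuousOn
  have hconst : ∀ {e x : ℝ}, θ =ᶠ[𝓝 x] (fun _ => e) → ‖iteratedDeriv n θ x‖ ≤ |e| := by
    intro e x h
    rw [h.iteratedDeriv_eq n, iteratedDeriv_const]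
    split_ifs <;> simp
  refine ⟨max C (max |c| |d|), fun x => ?_⟩
  rw [norm_iteratedFDeriv_eq_norm_iteratedDeriv]
  rcases lt_or_ge x a with hxa | hxa
  · exact (hconst (mem_of_superset (Iio_mem_nhds hxa) fun y hy => ha y (le_of_lt hy))).trans
      (by simp)
  rcases lt_or_ge b x with hxb | hxb
  · exact (hconst (mem_of_superset (Ioi_mem_nhds hxb) fun y hy => hb y (le_of_lt hy))).trans
      (by simp)
  · exact (hC x ⟨hxa, hxb⟩).trans (le_max_left _ _)

theorem exists_schwartz_family_cutoff_mul_laplaceOn_Ioi_one (hθ : ContDiff ℝ ∞ θ) {δ d : ℝ}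
    (hδ : 0 < δ) (hzero : ∀ x < δ, θ x = 0) (htop : ∀ᶠ x in atTop, θ x = d) {σ : ι → ℝ} {B : ℝ}
    (hσ : ∀ i, σ i ≤ B) :
    ∃ Φ : ι → 𝓢(ℝ, ℝ), IsVonNBounded ℝ (range Φ) ∧
      ∀ i x, Φ i x = θ x * laplaceOn (Ioi 1) (σ i) x := by
  have hsupp : tsupport θ ⊆ Ici δ :=
    closure_minimal (fun x hx => not_lt.1 fun hlt => hx (hzero x hlt)) isClosed_Ici
  refine exists_schwartz_family_cutoff_smul hθ
    (exists_norm_iteratedFDeriv_le_of_eventually_const hθ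
      ((eventually_lt_atBot δ).mono hzero) htop) isOpen_Ioi
    (hsupp.trans (Ici_subset_Ioi.2 hδ)) (fun i => contDiffOn_laplaceOn_Ioi_one (σ i))
    fun k n => ⟨2 ^ k * k.factorial * laplaceOn (Ioi 1) (B + n) (δ / 2), fun i x hx => ?_⟩
  rw [norm_iteratedFDeriv_eq_norm_iteratedDeriv, Real.norm_eq_abs, Real.norm_eq_abs,
    abs_of_pos (hδ.trans_le (hsupp hx)), abs_iteratedDeriv_laplaceOn measurableSet_Ioi
      (Ioi_subset_Ioi zero_le_one) isOpen_Ioi (fun _ => integrableOn_Ioi_one_rpow_mul_exp (σ i))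
      (hδ.trans_le (hsupp hx))]
  exact pow_mul_laplaceOn_Ioi_one_le hδ (add_le_add_left (hσ i) _) (hsupp hx) k

theorem exists_schwartz_family_cutoff_mul_laplaceOn_Ioo (hθ : ContDiff ℝ ∞ θ)
    (hθ_supp : HasCompactSupport θ) {σ : ι → ℝ} {A : ℝ} (hA : -1 < A) (hσ : ∀ i, A ≤ σ i) :
    ∃ Φ : ι → 𝓢(ℝ, ℝ), IsVonNBounded ℝ (range Φ) ∧
      ∀ i x, Φ i x = θ x * laplaceOn (Ioo 0 1) (σ i) x := by
  obtain ⟨X, hX⟩ := hθ_supp.isCompact.isBounded.exists_norm_le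
  refine exists_schwartz_family_cutoff_smul hθ (fun n => ?_) isOpen_univ (subset_univ _)
    (fun i => (contDiff_laplaceOn_Ioo (hA.trans_le (hσ i))).contDiffOn)
    fun k n => ⟨X ^ k * laplaceOn (Ioo 0 1) A (-X), fun i x hx => ?_⟩
  · exact ⟨_, (hθ_supp.toSchwartzMap hθ).norm_iteratedFDeriv_le_seminorm ℝ n⟩
  · rw [norm_iteratedFDeriv_eq_norm_iteratedDeriv, Real.norm_eq_abs (iteratedDeriv _ _ _),
      abs_iteratedDeriv_laplaceOn measurableSet_Ioo Ioo_subset_Ioi_self isOpen_univ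
        (fun x _ => integrableOn_Ioo_rpow_mul_exp (hA.trans_le (hσ i)) x) (mem_univ x)]
    exact mul_le_mul (pow_le_pow_left₀ (norm_nonneg x) (hX x hx) k)
      (laplaceOn_Ioo_le hA (le_add_of_le_of_nonneg (hσ i) n.cast_nonneg) (hX x hx))
      (laplaceOn_nonneg measurableSet_Ioo Ioo_subset_Ioi_self _ _)
      (pow_nonneg ((norm_nonneg x).trans (hX x hx)) k)

theorem continuous_inv_Gamma : Continuous fun s : ℝ => (Real.Gamma s)⁻¹ := by
  have h : Continuous fun s : ℝ => ((Complex.Gamma (s : ℂ))⁻¹).re :=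
    Complex.continuous_re.comp
      (Complex.differentiable_one_div_Gamma.continuous.comp Complex.continuous_ofReal)
  refine h.congr fun s => ?_
  rw [Complex.Gamma_ofReal, ← Complex.ofReal_inv, Complex.ofReal_re]

theorem exists_abs_inv_Gamma_le {u : ι → ℝ} {A B : ℝ} (hu : ∀ i, u i ∈ Icc A B) :
    ∃ M : ℝ, ∀ i, |(Real.Gamma (u i))⁻¹| ≤ M := by
  obtain ⟨M, hM⟩ := (isCompact_Icc (a := A) (b := B)).exists_bound_of_continuousOn
    continuous_inv_Gamma.continuousOn
  exact ⟨M, fun i => hM _ (hu i)⟩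

theorem mul_inv_Gamma_add_one (s : ℝ) : s * (Real.Gamma (s + 1))⁻¹ = (Real.Gamma s)⁻¹ := by
  rcases eq_or_ne s 0 with rfl | hs
  · simp [Real.Gamma_zero]
  · rw [Real.Gamma_add_one hs, mul_inv, mul_inv_cancel_left₀ hs]

theorem rpow_neg_sub_one_eq_inv_Gamma_mul_laplaceOn {σ x : ℝ} (hσ : -1 < σ) (hx : 0 < x) :
    x ^ (-σ - 1) = (Real.Gamma (σ + 1))⁻¹ * laplaceOn (Ioi 1) σ x +
      (Real.Gamma (σ + 1))⁻¹ * laplaceOn (Ioo 0 1) σ x := by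
  have hΓ : Real.Gamma (σ + 1) ≠ 0 := (Real.Gamma_pos_of_pos (by linarith)).ne'
  rw [← mul_add, add_comm (laplaceOn _ _ _), laplaceOn_Ioo_add_laplaceOn_Ioi hσ hx,
    inv_mul_cancel_left₀ hΓ]

theorem mul_inv_Gamma_mul_laplaceOn_Ioi_one (σ : ℝ) {x : ℝ} (hx : 0 < x) :
    x * ((Real.Gamma (σ + 1))⁻¹ * laplaceOn (Ioi 1) σ x) =
      (Real.Gamma σ)⁻¹ * laplaceOn (Ioi 1) (σ - 1) x +
        (Real.Gamma (σ + 1))⁻¹ * Real.exp (-x) := by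
  linear_combination (Real.Gamma (σ + 1))⁻¹ * mul_laplaceOn_Ioi_one σ hx +
    laplaceOn (Ioi 1) (σ - 1) x * mul_inv_Gamma_add_one σ

-- Integration by parts trades `σ` for `σ + 1` up to a multiple of `exp (-x)`, so the claim extends
-- from `σ > -1`, where the lower incomplete integral converges, to all `σ`.
theorem exists_schwartz_family_cutoff_mul_rpow (n : ℕ) (hθ : ContDiff ℝ ∞ θ)
    (hθ_supp : HasCompactSupport θ) {σ : ι → ℝ} {A B : ℝ} (hσ : ∀ i, σ i ∈ Icc A B)
    (hA : -(n + 1) < A) :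
    ∃ Φ : ι → 𝓢(ℝ, ℝ), IsVonNBounded ℝ (range Φ) ∧ ∀ i x, 0 < x →
      θ x * x ^ (-σ i - 1) =
        θ x * ((Real.Gamma (σ i + 1))⁻¹ * laplaceOn (Ioi 1) (σ i) x) + Φ i x := by
  induction n generalizing θ σ A B with
  | zero =>
    rw [Nat.cast_zero, zero_add] at hA
    obtain ⟨M, hM⟩ := exists_abs_inv_Gamma_le (u := fun i => σ i + 1) (A := A + 1) (B := B + 1)
      fun i => ⟨by linarith [(hσ i).1], by linarith [(hσ i).2]⟩
    obtain ⟨Φ, hΦ, hΦ_apply⟩ :=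
      exists_schwartz_family_cutoff_mul_laplaceOn_Ioo hθ hθ_supp hA fun i => (hσ i).1
    refine ⟨_, isVonNBounded_range_smul hM hΦ, fun i x hx => ?_⟩
    rw [smul_apply, hΦ_apply, smul_eq_mul,
      rpow_neg_sub_one_eq_inv_Gamma_mul_laplaceOn (hA.trans_le (hσ i).1) hx]
    ring
  | succ n ih =>
    obtain ⟨M, hM⟩ := exists_abs_inv_Gamma_le (u := fun i => σ i + 1 + 1) (A := A + 2) (B := B + 2)
      fun i => ⟨by linarith [(hσ i).1], by linarith [(hσ i).2]⟩
    obtain ⟨Φ, hΦ, hΦ_apply⟩ := ih (θ := fun x => θ x * x) (hθ.mul contDiff_id) hθ_supp.mul_right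
      (σ := fun i => σ i + 1) (A := A + 1) (B := B + 1)
      (fun i => ⟨by linarith [(hσ i).1], by linarith [(hσ i).2]⟩) (by push_cast at hA; linarith)
    let ψ : 𝓢(ℝ, ℝ) := HasCompactSupport.toSchwartzMap (f := fun x => θ x * Real.exp (-x))
      hθ_supp.mul_right (hθ.mul (Real.contDiff_exp.comp contDiff_neg))
    have hψ : IsVonNBounded ℝ (range fun _ : ι => ψ) :=
      (isVonNBounded_singleton ψ).subset range_const_subset
    refine ⟨_, isVonNBounded_range_add (isVonNBounded_range_smul hM hψ) hΦ, fun i x hx => ?_⟩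
    have hrec := mul_inv_Gamma_mul_laplaceOn_Ioi_one (σ i + 1) hx
    rw [add_sub_cancel_right] at hrec
    have hψ_apply : ψ x = θ x * Real.exp (-x) := rfl
    have hpow : x ^ (-σ i - 1) = x * x ^ (-(σ i + 1) - 1) := by
      rw [neg_add', Real.rpow_sub_one hx.ne' (-σ i - 1), mul_div_cancel₀ _ hx.ne']
    rw [add_apply, smul_apply, hψ_apply, smul_eq_mul, hpow]
    linear_combination hΦ_apply i x hx + θ x * hrec

theorem exists_schwartz_family_rpow_sub_laplaceOn (hθ : ContDiff ℝ ∞ θ) {δ : ℝ} (hδ : 0 < δ)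
    (hone : ∀ x < δ, θ x = 1) (htop : ∀ᶠ x in atTop, θ x = 0) {σ : ι → ℝ} {A B : ℝ}
    (hσ : ∀ i, σ i ∈ Icc A B) :
    ∃ Φ : ι → 𝓢(ℝ, ℝ), IsVonNBounded ℝ (range Φ) ∧ ∀ i x, 0 < x →
      θ x * x ^ (-σ i - 1) = (Real.Gamma (σ i + 1))⁻¹ * laplaceOn (Ioi 1) (σ i) x + Φ i x := by
  obtain ⟨n, hn⟩ := exists_nat_gt (-A)
  obtain ⟨b, hb⟩ := eventually_atTop.1 htop
  obtain ⟨M, hM⟩ := exists_abs_inv_Gamma_le (u := fun i => σ i + 1) (A := A + 1) (B := B + 1)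
    fun i => ⟨by linarith [(hσ i).1], by linarith [(hσ i).2]⟩
  let η : ℝ → ℝ := fun x => θ x * Real.smoothTransition (x + 1)
  have hη : ContDiff ℝ ∞ η :=
    hθ.mul (Real.smoothTransition.contDiff.comp (contDiff_id.add contDiff_const))
  have hη_supp : HasCompactSupport η := by
    refine HasCompactSupport.intro (isCompact_Icc (a := -1) (b := b)) fun x hx => ?_
    rcases lt_or_ge x (-1) with hx1 | hx1
    · simp [η, Real.smoothTransition.zero_of_nonpos (show x + 1 ≤ 0 by linarith)]
    · simp [η, hb x (le_of_not_ge fun hxb => hx ⟨hx1, hxb⟩)]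
  have hη_eq : ∀ x, 0 < x → η x = θ x := fun x hx => by
    simp [η, Real.smoothTransition.one_of_one_le (show 1 ≤ x + 1 by linarith)]
  obtain ⟨Φ, hΦ, hΦ_apply⟩ :=
    exists_schwartz_family_cutoff_mul_rpow n hη hη_supp hσ (by linarith)
  obtain ⟨Ψ, hΨ, hΨ_apply⟩ := exists_schwartz_family_cutoff_mul_laplaceOn_Ioi_one
    (θ := fun x => θ x - 1) (hθ.sub contDiff_const) (d := -1) hδ
    (fun x hx => by simp [hone x hx]) (htop.mono fun x hx => by simp [hx]) fun i => (hσ i).2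
  refine ⟨_, isVonNBounded_range_add hΦ (isVonNBounded_range_smul hM hΨ), fun i x hx => ?_⟩
  have hΦ_eq := hΦ_apply i x hx
  rw [hη_eq x hx] at hΦ_eq
  rw [add_apply, smul_apply, hΨ_apply, smul_eq_mul]
  linear_combination hΦ_eq

end CutoffLaplace

section AngularFourier

variable {V : Type*} [NormedAddCommGroup V] [InnerProductSpace ℝ V] [FiniteDimensional ℝ V]
  [MeasurableSpace V] [BorelSpace V]

/-- The Fourier transform `∫ exp(-i ⟪y, ξ⟫) f(y) dy`. Mathlib's `𝓕` carries an additional factor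
`2π` in the exponent. -/
noncomputable def angularFourier (f : V → ℂ) (ξ : V) : ℂ :=
  ∫ y, Complex.exp (-Complex.I * ((⟪y, ξ⟫_ℝ : ℝ) : ℂ)) * f y

theorem angularFourier_eq_fourier (f : V → ℂ) (ξ : V) :
    angularFourier f ξ = 𝓕 f ((2 * Real.pi)⁻¹ • ξ) := by
  rw [angularFourier, Real.fourier_eq']
  refine integral_congr_ae (Eventually.of_forall fun y => ?_)
  simp only [inner_smul_right, smul_eq_mul]
  congr 2
  push_cast
  field_simp

theorem norm_exp_neg_I_mul_ofReal (r : ℝ) : ‖Complex.exp (-Complex.I * (r : ℂ))‖ = 1 := by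
  rw [neg_mul, mul_comm, ← neg_mul, ← Complex.ofReal_neg, Complex.norm_exp_ofReal_mul_I]

theorem exists_schwartz_angularFourier :
    ∃ T : 𝓢(V, ℂ) →L[ℝ] 𝓢(V, ℂ), ∀ f ξ, T f ξ = angularFourier f ξ := by
  have h2 : (2 * Real.pi)⁻¹ ≠ 0 := by positivity
  refine ⟨(SchwartzMap.compCLMOfContinuousLinearEquiv ℝ
    (ContinuousLinearEquiv.smulLeft (Units.mk0 _ h2) : V ≃L[ℝ] V)).comp
    (FourierTransform.fourierCLM ℝ 𝓢(V, ℂ)), fun f ξ => ?_⟩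
  rw [angularFourier_eq_fourier, ← SchwartzMap.fourier_coe]
  rfl

theorem angularFourier_const_mul (c : ℂ) (f : V → ℂ) (ξ : V) :
    angularFourier (fun y => c * f y) ξ = c * angularFourier f ξ := by
  simp only [angularFourier, mul_left_comm _ c, integral_const_mul]

theorem angularFourier_inner_mul {g : V → ℂ} (hg : Integrable g)
    (hg' : Integrable fun y => ‖y‖ * ‖g y‖) {v ξ : V} {D : ℂ}
    (hD : HasLineDerivAt ℝ (angularFourier g) D ξ v) :
    angularFourier (fun y => ((⟪y, v⟫_ℝ : ℝ) : ℂ) * g y) ξ = Complex.I * D := by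
  have hint : Integrable (VectorFourier.fourierSMulRight (innerSL ℝ) g) :=
    (hg'.const_mul (2 * Real.pi * ‖(innerSL ℝ : V →L[ℝ] V →L[ℝ] ℝ)‖)).mono'
      hg.1.fourierSMulRight (Eventually.of_forall fun y => by
        simpa only [mul_assoc] using VectorFourier.norm_fourierSMulRight_le (innerSL ℝ) g y)
  have hderiv : HasLineDerivAt ℝ (angularFourier g)
      (angularFourier (fun y => -Complex.I * (((⟪y, v⟫_ℝ : ℝ) : ℂ) * g y)) ξ) ξ v := by
    have h := ((Real.hasFDerivAt_fourier hg hg' ((2 * Real.pi)⁻¹ • ξ)).comp ξ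
      ((hasFDerivAt_id ξ).const_smul (2 * Real.pi)⁻¹)).hasLineDerivAt v
    convert h using 1
    · exact funext (angularFourier_eq_fourier g)
    · simp only [ContinuousLinearMap.comp_apply, smul_apply, ContinuousLinearMap.id_apply]
      rw [Real.fourier_continuousLinearMap_apply hint, angularFourier_eq_fourier]
      refine congrArg (fun F : V → ℂ => 𝓕 F ((2 * Real.pi)⁻¹ • ξ)) (funext fun y => ?_)
      simp only [VectorFourier.fourierSMulRight_apply, innerSL_apply_apply ℝ, inner_smul_right,
        smul_eq_mul, Complex.real_smul]
      push_cast
      field_simp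
  rw [hD.unique hderiv, angularFourier_const_mul, ← mul_assoc, mul_neg, Complex.I_mul_I, neg_neg,
    one_mul]

end AngularFourier

section Gaussian

variable {V : Type*} [NormedAddCommGroup V] [InnerProductSpace ℝ V] [FiniteDimensional ℝ V]
  [MeasurableSpace V] [BorelSpace V] {t : ℝ}

theorem integrable_gaussian (ht : 0 < t) :
    Integrable (fun y : V => Real.exp (-(t * ‖y‖ ^ 2))) := by
  refine Integrable.of_integral_ne_zero ?_
  simp_rw [← neg_mul]
  rw [GaussianFourier.integral_rexp_neg_mul_sq_norm ht]
  positivity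

theorem norm_sq_pow_mul_gaussian_le {E : Type*} [SeminormedAddGroup E] (ht : 0 < t) (k : ℕ)
    (y : E) : (‖y‖ ^ 2) ^ k * Real.exp (-(t * ‖y‖ ^ 2)) ≤
      2 ^ k * k.factorial / t ^ k * Real.exp (-(t / 2 * ‖y‖ ^ 2)) := by
  have h := pow_mul_exp_neg_half_le k (x := t * ‖y‖ ^ 2) (by positivity)
  rw [mul_pow] at h
  have hexp : Real.exp (-(t * ‖y‖ ^ 2)) =
      Real.exp (-(t * ‖y‖ ^ 2 / 2)) * Real.exp (-(t / 2 * ‖y‖ ^ 2)) := by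
    rw [← Real.exp_add]
    ring_nf
  rw [hexp, ← mul_assoc]
  gcongr
  rwa [le_div_iff₀' (by positivity), ← mul_assoc]

theorem integrable_mul_gaussian (ht : 0 < t) {p : V → ℝ} (hp : Continuous p) {C : ℝ} {k : ℕ}
    (hpC : ∀ y, |p y| ≤ C * ‖y‖ ^ k) :
    Integrable (fun y : V => p y * Real.exp (-(t * ‖y‖ ^ 2))) := by
  have hpow : Integrable fun y : V => (‖y‖ ^ 2) ^ k * Real.exp (-(t * ‖y‖ ^ 2)) :=
    ((integrable_gaussian (half_pos ht)).const_mul (2 ^ k * k.factorial / t ^ k)).mono'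
      (by fun_prop) (Eventually.of_forall fun y => by
        rw [Real.norm_of_nonneg (by positivity)]
        exact norm_sq_pow_mul_gaussian_le ht k y)
  refine (((integrable_gaussian ht).add hpow).const_mul |C|).mono' (by fun_prop)
    (Eventually.of_forall fun y => ?_)
  simp only [Pi.add_apply, norm_mul, Real.norm_eq_abs, Real.abs_exp]
  rw [← one_add_mul, ← mul_assoc]
  gcongr
  calc |p y| ≤ C * ‖y‖ ^ k := hpC y
    _ ≤ |C| * (1 + (‖y‖ ^ 2) ^ k) := by
      gcongr
      · exact le_abs_self C
      · rw [← pow_mul, mul_comm, pow_mul]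
        nlinarith [sq_nonneg (‖y‖ ^ k - 1)]

theorem angularFourier_gaussian (ht : 0 < t) (ξ : V) :
    angularFourier (fun y => ((Real.exp (-(t * ‖y‖ ^ 2)) : ℝ) : ℂ)) ξ =
      (((Real.pi / t) ^ (Module.finrank ℝ V / 2 : ℝ) *
        Real.exp (-(‖ξ‖ ^ 2 / (4 * t))) : ℝ) : ℂ) := by
  have h := GaussianFourier.integral_cexp_neg_mul_sq_norm_add (V := V) (b := (t : ℂ))
    (by simpa using ht) (-Complex.I) ξ
  rw [Complex.ofReal_mul, Complex.ofReal_exp, Complex.ofReal_cpow (by positivity)]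
  push_cast
  rw [neg_sq, Complex.I_sq] at h
  convert h using 2
  · refine integral_congr_ae (Eventually.of_forall fun y => ?_)
    simp only
    rw [← Complex.exp_add, real_inner_comm]
    congr 1
    ring
  · ring_nf

theorem hasLineDerivAt_gaussian {E : Type*} [NormedAddCommGroup E] [InnerProductSpace ℝ E] (t : ℝ)
    (ξ v : E) :
    HasLineDerivAt ℝ (fun ξ : E => Real.exp (-(‖ξ‖ ^ 2 / (4 * t))))
      (-(⟪ξ, v⟫_ℝ / (2 * t)) * Real.exp (-(‖ξ‖ ^ 2 / (4 * t)))) ξ v := by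
  have hsq : HasDerivAt (fun τ : ℝ => ‖ξ + τ • v‖ ^ 2) (2 * ⟪ξ, v⟫_ℝ) 0 := by
    simpa [HasLineDerivAt] using (hasStrictFDerivAt_norm_sq ξ).hasFDerivAt.hasLineDerivAt v
  refine ((hsq.div_const (4 * t)).fun_neg.exp).congr_deriv ?_
  simp only [zero_smul, add_zero]
  ring

theorem angularFourier_inner_mul_mul_gaussian (ht : 0 < t) {p : V → ℝ} (hp : Continuous p) {C : ℝ}
    {k : ℕ} (hpC : ∀ y, |p y| ≤ C * ‖y‖ ^ k) {v ξ : V} {D : ℂ} (hD : HasLineDerivAt ℝ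
      (angularFourier fun y => ((p y * Real.exp (-(t * ‖y‖ ^ 2)) : ℝ) : ℂ)) D ξ v) :
    angularFourier (fun y => ((⟪y, v⟫_ℝ * p y * Real.exp (-(t * ‖y‖ ^ 2)) : ℝ) : ℂ)) ξ =
      Complex.I * D := by
  have hmul : Integrable fun y : V => ‖y‖ * p y * Real.exp (-(t * ‖y‖ ^ 2)) :=
    integrable_mul_gaussian ht (by fun_prop) (C := C) (k := k + 1) fun y => by
      rw [abs_mul, abs_norm, pow_succ', mul_left_comm]
      gcongr
      exact hpC y
  rw [← angularFourier_inner_mul (integrable_mul_gaussian ht hp hpC).ofReal ?_ hD]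
  · simp only [mul_assoc, Complex.ofReal_mul, RCLike.ofReal_eq_complex_ofReal]
  · simpa only [RCLike.norm_ofReal, norm_mul, norm_norm, mul_assoc, abs_mul, abs_norm,
      Real.norm_eq_abs] using hmul.norm

theorem angularFourier_inner_mul_gaussian (ht : 0 < t) (v ξ : V) :
    angularFourier (fun y => ((⟪y, v⟫_ℝ * Real.exp (-(t * ‖y‖ ^ 2)) : ℝ) : ℂ)) ξ =
      Complex.I * (((Real.pi / t) ^ (Module.finrank ℝ V / 2 : ℝ) *
        (-(⟪ξ, v⟫_ℝ / (2 * t)) * Real.exp (-(‖ξ‖ ^ 2 / (4 * t)))) : ℝ) : ℂ) := by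
  have h := angularFourier_inner_mul_mul_gaussian ht (p := fun _ : V => 1) (C := 1) (k := 0)
    (v := v) (ξ := ξ) continuous_const (by simp) (D := _) (by
      simp only [one_mul, funext (angularFourier_gaussian ht)]
      exact ((hasLineDerivAt_gaussian t ξ v).const_mul _).ofReal_comp)
  simpa only [mul_one] using h

theorem angularFourier_inner_mul_inner_mul_gaussian (ht : 0 < t) (v w ξ : V) :
    angularFourier (fun y => ((⟪y, v⟫_ℝ * ⟪y, w⟫_ℝ * Real.exp (-(t * ‖y‖ ^ 2)) : ℝ) : ℂ)) ξ =
      (((Real.pi / t) ^ (Module.finrank ℝ V / 2 : ℝ) / (2 * t) *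
        (⟪v, w⟫_ℝ - ⟪ξ, v⟫_ℝ * ⟪ξ, w⟫_ℝ / (2 * t)) * Real.exp (-(‖ξ‖ ^ 2 / (4 * t))) : ℝ) : ℂ) := by
  have hinner : HasDerivAt (fun τ : ℝ => ⟪ξ + τ • v, w⟫_ℝ) ⟪v, w⟫_ℝ 0 := by
    simp only [inner_add_left, real_inner_smul_left]
    simpa using ((hasDerivAt_id (0 : ℝ)).mul_const ⟪v, w⟫_ℝ).const_add ⟪ξ, w⟫_ℝ
  have hderiv := (((((hinner.div_const (2 * t)).fun_neg.fun_mul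
    (hasLineDerivAt_gaussian t ξ v)).const_mul
    ((Real.pi / t) ^ (Module.finrank ℝ V / 2 : ℝ))).ofReal_comp).const_mul Complex.I)
  rw [angularFourier_inner_mul_mul_gaussian ht (by fun_prop) (C := ‖w‖) (k := 1)
    (fun y => by simpa only [pow_one, mul_comm] using abs_real_inner_le_norm y w)
    (by rw [funext (angularFourier_inner_mul_gaussian ht w)]; exact hderiv),
    ← mul_assoc, Complex.I_mul_I, neg_one_mul, ← Complex.ofReal_neg]
  simp only [zero_smul, add_zero]
  congr 1
  ring

theorem inner_apply_self_eq_sum {ι E : Type*} [Fintype ι] [NormedAddCommGroup E]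
    [InnerProductSpace ℝ E] (A : E →L[ℝ] E) (b : OrthonormalBasis ι ℝ E) (y : E) :
    ⟪A y, y⟫_ℝ = ∑ i, ⟪y, b i⟫_ℝ * ⟪y, A (b i)⟫_ℝ := by
  nth_rw 1 [← b.sum_repr' y]
  simp only [real_inner_comm y, map_sum, map_smul, inner_sum, real_inner_smul_right]

theorem abs_inner_apply_self_le {E : Type*} [NormedAddCommGroup E] [InnerProductSpace ℝ E]
    (A : E →L[ℝ] E) (y : E) : |⟪A y, y⟫_ℝ| ≤ ‖A‖ * ‖y‖ ^ 2 := by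
  rw [sq, ← mul_assoc]
  exact (abs_real_inner_le_norm _ _).trans
    (mul_le_mul_of_nonneg_right (A.le_opNorm y) (norm_nonneg y))

theorem angularFourier_quadratic_mul_gaussian (ht : 0 < t) {A : V →L[ℝ] V}
    (hA : LinearMap.trace ℝ V A = 0) (ξ : V) :
    angularFourier (fun y => ((⟪A y, y⟫_ℝ * Real.exp (-(t * ‖y‖ ^ 2)) : ℝ) : ℂ)) ξ =
      ((-((Real.pi / t) ^ (Module.finrank ℝ V / 2 : ℝ) / (4 * t ^ 2)) *
        (⟪A ξ, ξ⟫_ℝ * Real.exp (-(‖ξ‖ ^ 2 / (4 * t)))) : ℝ) : ℂ) := by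
  let b := stdOrthonormalBasis ℝ V
  have htrace : ∑ i, ⟪b i, A (b i)⟫_ℝ = 0 := by
    rw [← hA, LinearMap.trace_eq_sum_inner _ b]
    rfl
  have hint : ∀ v w : V, Integrable fun y => Complex.exp (-Complex.I * ((⟪y, ξ⟫_ℝ : ℝ) : ℂ)) *
      ((⟪y, v⟫_ℝ * ⟪y, w⟫_ℝ * Real.exp (-(t * ‖y‖ ^ 2)) : ℝ) : ℂ) := fun v w => by
    have h := integrable_mul_gaussian ht (p := fun y : V => ⟪y, v⟫_ℝ * ⟪y, w⟫_ℝ) (by fun_prop)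
      (C := ‖v‖ * ‖w‖) (k := 2) fun y => by
        rw [abs_mul, sq, mul_mul_mul_comm, mul_comm ‖v‖, mul_comm ‖w‖]
        exact mul_le_mul (abs_real_inner_le_norm y v) (abs_real_inner_le_norm y w) (abs_nonneg _)
          (by positivity)
    refine h.norm.mono' (by fun_prop) (Eventually.of_forall fun y => ?_)
    rw [norm_mul, norm_exp_neg_I_mul_ofReal, one_mul, Complex.norm_real]
  calc angularFourier (fun y => ((⟪A y, y⟫_ℝ * Real.exp (-(t * ‖y‖ ^ 2)) : ℝ) : ℂ)) ξ
      = ∑ i, angularFourier (fun y =>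
          ((⟪y, b i⟫_ℝ * ⟪y, A (b i)⟫_ℝ * Real.exp (-(t * ‖y‖ ^ 2)) : ℝ) : ℂ)) ξ := by
        simp only [angularFourier]
        rw [← integral_finsetSum _ fun i _ => hint (b i) (A (b i))]
        simp only [inner_apply_self_eq_sum A b, Finset.sum_mul, Complex.ofReal_sum, Finset.mul_sum]
    _ = _ := by
        simp only [angularFourier_inner_mul_inner_mul_gaussian ht]
        rw [← Complex.ofReal_sum, ← Finset.sum_mul, ← Finset.mul_sum, Finset.sum_sub_distrib,
          htrace, ← Finset.sum_div, ← inner_apply_self_eq_sum A b]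
        congr 1
        field_simp
        ring

end Gaussian

section FourierLaplace

variable {V : Type*} [NormedAddCommGroup V] [InnerProductSpace ℝ V] [FiniteDimensional ℝ V]
  [MeasurableSpace V] [BorelSpace V] {σ t : ℝ}

theorem integral_abs_quadratic_mul_gaussian_le (A : V →L[ℝ] V) (ht : 0 < t) :
    ∫ y : V, |⟪A y, y⟫_ℝ| * Real.exp (-(t * ‖y‖ ^ 2)) ≤
      2 * ‖A‖ * (2 * Real.pi) ^ (Module.finrank ℝ V / 2 : ℝ) *
        t ^ (-(Module.finrank ℝ V / 2 : ℝ) - 1) := by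
  calc ∫ y : V, |⟪A y, y⟫_ℝ| * Real.exp (-(t * ‖y‖ ^ 2))
      ≤ ∫ y : V, ‖A‖ * (2 / t) * Real.exp (-(t / 2) * ‖y‖ ^ 2) := by
        simp only [neg_mul]
        refine integral_mono_of_nonneg (Eventually.of_forall fun y => by positivity)
          ((integrable_gaussian (half_pos ht)).const_mul _) (Eventually.of_forall fun y => ?_)
        have h := norm_sq_pow_mul_gaussian_le ht 1 y
        simp only [pow_one, Nat.factorial_one, Nat.cast_one, mul_one] at h
        calc |⟪A y, y⟫_ℝ| * Real.exp (-(t * ‖y‖ ^ 2))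
            ≤ ‖A‖ * ‖y‖ ^ 2 * Real.exp (-(t * ‖y‖ ^ 2)) :=
              mul_le_mul_of_nonneg_right (abs_inner_apply_self_le A y) (Real.exp_pos _).le
          _ ≤ ‖A‖ * (2 / t) * Real.exp (-(t / 2 * ‖y‖ ^ 2)) := by
              rw [mul_assoc, mul_assoc]
              gcongr
    _ = _ := by
        rw [integral_const_mul, GaussianFourier.integral_rexp_neg_mul_sq_norm (half_pos ht),
          show Real.pi / (t / 2) = 2 * Real.pi / t by field_simp,
          Real.div_rpow (by positivity) ht.le, Real.rpow_sub ht, Real.rpow_one, Real.rpow_neg ht.le]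
        field_simp

theorem integrable_prod_quadratic_mul_rpow_mul_exp (A : V →L[ℝ] V)
    (hσ : σ < Module.finrank ℝ V / 2) :
    Integrable (fun p : V × ℝ => ⟪A p.1, p.1⟫_ℝ * (p.2 ^ σ * Real.exp (-(p.2 * ‖p.1‖ ^ 2))))
      (volume.prod (volume.restrict (Ioi 1))) := by
  have hm : AEStronglyMeasurable
      (fun p : V × ℝ => ⟪A p.1, p.1⟫_ℝ * (p.2 ^ σ * Real.exp (-(p.2 * ‖p.1‖ ^ 2))))
      (volume.prod (volume.restrict (Ioi 1))) := Measurable.aestronglyMeasurable (by fun_prop)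
  have hswap : ∀ (t : ℝ) (y : V), ⟪A y, y⟫_ℝ * (t ^ σ * Real.exp (-(t * ‖y‖ ^ 2))) =
      t ^ σ * (⟪A y, y⟫_ℝ * Real.exp (-(t * ‖y‖ ^ 2))) := fun t y => mul_left_comm _ _ _
  rw [integrable_prod_iff' hm]
  constructor
  · refine (ae_restrict_iff' measurableSet_Ioi).2 (Eventually.of_forall fun t (ht : 1 < t) => ?_)
    simp only [hswap]
    exact (integrable_mul_gaussian (zero_lt_one.trans ht) (by fun_prop)
      (abs_inner_apply_self_le A)).const_mul _
  · have hbound : IntegrableOn (fun t : ℝ =>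
        2 * ‖A‖ * (2 * Real.pi) ^ (Module.finrank ℝ V / 2 : ℝ) *
          t ^ (σ + (-(Module.finrank ℝ V / 2 : ℝ) - 1))) (Ioi 1) :=
      (integrableOn_Ioi_rpow_of_lt (by linarith) zero_lt_one).const_mul _
    refine hbound.mono' hm.norm.prod_swap.integral_prod_right'
      ((ae_restrict_iff' measurableSet_Ioi).2 (Eventually.of_forall fun t (ht : 1 < t) => ?_))
    have ht0 : 0 < t := zero_lt_one.trans ht
    rw [Real.norm_of_nonneg (integral_nonneg fun _ => norm_nonneg _)]
    simp only [hswap, norm_mul, Real.norm_eq_abs, Real.abs_exp,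
      abs_of_nonneg (Real.rpow_nonneg ht0.le σ)]
    rw [integral_const_mul, Real.rpow_add ht0, mul_left_comm]
    exact mul_le_mul_of_nonneg_left (integral_abs_quadratic_mul_gaussian_le A ht0)
      (Real.rpow_nonneg ht0.le σ)

theorem integrable_quadratic_mul_laplaceOn (A : V →L[ℝ] V) (hσ : σ < Module.finrank ℝ V / 2) :
    Integrable fun y : V => ⟪A y, y⟫_ℝ * laplaceOn (Ioi 1) σ (‖y‖ ^ 2) := by
  simpa only [integral_const_mul, laplaceOn] using
    (integrable_prod_quadratic_mul_rpow_mul_exp A hσ).integral_prod_left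

theorem integral_Ioi_one_rpow_mul_exp_div (τ x : ℝ) :
    ∫ t in Ioi (1 : ℝ), t ^ (-τ - 2) * Real.exp (-(x / t)) = laplaceOn (Ioo 0 1) τ x := by
  have himage : Inv.inv '' Ioi (1 : ℝ) = Ioo 0 1 := by
    rw [image_inv_eq_inv, inv_Ioi₀ one_pos, inv_one]
  have hderiv : ∀ t ∈ Ioi (1 : ℝ), HasDerivWithinAt Inv.inv (-(t ^ 2)⁻¹) (Ioi 1) t :=
    fun t (ht : 1 < t) => (hasDerivAt_inv (zero_lt_one.trans ht).ne').hasDerivWithinAt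
  rw [laplaceOn, ← himage, integral_image_eq_integral_abs_deriv_smul measurableSet_Ioi hderiv
    inv_injective.injOn]
  refine setIntegral_congr_fun measurableSet_Ioi fun t (ht : 1 < t) => ?_
  have ht0 : 0 < t := zero_lt_one.trans ht
  simp only [smul_eq_mul]
  rw [abs_neg, abs_of_pos (by positivity), Real.inv_rpow ht0.le, ← Real.rpow_neg ht0.le,
    Real.rpow_sub ht0, Real.rpow_two, inv_mul_eq_div t x, div_eq_inv_mul (t ^ (-τ)), mul_assoc]

theorem angularFourier_quadratic_mul_laplaceOn {A : V →L[ℝ] V} (hA : LinearMap.trace ℝ V A = 0)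
    (hσ : σ < Module.finrank ℝ V / 2) (ξ : V) :
    angularFourier (fun y => ((⟪A y, y⟫_ℝ * laplaceOn (Ioi 1) σ (‖y‖ ^ 2) : ℝ) : ℂ)) ξ =
      ((-(Real.pi ^ (Module.finrank ℝ V / 2 : ℝ) / 4) * (⟪A ξ, ξ⟫_ℝ *
        laplaceOn (Ioo 0 1) (Module.finrank ℝ V / 2 - σ) (‖ξ‖ ^ 2 / 4)) : ℝ) : ℂ) := by
  have hint : Integrable (fun p : V × ℝ => Complex.exp (-Complex.I * ((⟪p.1, ξ⟫_ℝ : ℝ) : ℂ)) *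
      ((⟪A p.1, p.1⟫_ℝ * (p.2 ^ σ * Real.exp (-(p.2 * ‖p.1‖ ^ 2))) : ℝ) : ℂ))
      (volume.prod (volume.restrict (Ioi 1))) := by
    have h := integrable_prod_quadratic_mul_rpow_mul_exp A hσ
    refine h.norm.mono' (by have := h.1; fun_prop) (Eventually.of_forall fun p => ?_)
    rw [norm_mul, norm_exp_neg_I_mul_ofReal, one_mul, Complex.norm_real]
  calc angularFourier (fun y => ((⟪A y, y⟫_ℝ * laplaceOn (Ioi 1) σ (‖y‖ ^ 2) : ℝ) : ℂ)) ξ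
      = ∫ y : V, ∫ t in Ioi (1 : ℝ), Complex.exp (-Complex.I * ((⟪y, ξ⟫_ℝ : ℝ) : ℂ)) *
          ((⟪A y, y⟫_ℝ * (t ^ σ * Real.exp (-(t * ‖y‖ ^ 2))) : ℝ) : ℂ) := by
        simp only [angularFourier, laplaceOn, integral_const_mul, integral_complex_ofReal]
    _ = ∫ t in Ioi (1 : ℝ), angularFourier (fun y =>
          ((t ^ σ : ℝ) : ℂ) * ((⟪A y, y⟫_ℝ * Real.exp (-(t * ‖y‖ ^ 2)) : ℝ) : ℂ)) ξ := by
        rw [integral_integral_swap hint]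
        simp only [angularFourier, ← Complex.ofReal_mul, mul_left_comm (_ ^ σ : ℝ)]
    _ = ∫ t in Ioi (1 : ℝ), ((-(Real.pi ^ (Module.finrank ℝ V / 2 : ℝ) / 4) * (⟪A ξ, ξ⟫_ℝ *
          (t ^ (-(Module.finrank ℝ V / 2 - σ) - 2) * Real.exp (-(‖ξ‖ ^ 2 / 4 / t)))) : ℝ) : ℂ) := by
        refine setIntegral_congr_fun measurableSet_Ioi fun t (ht : 1 < t) => ?_
        have ht0 : 0 < t := zero_lt_one.trans ht
        simp only [angularFourier_const_mul, angularFourier_quadratic_mul_gaussian ht0 hA]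
        rw [← Complex.ofReal_mul, Real.div_rpow Real.pi_pos.le ht0.le,
          show -(Module.finrank ℝ V / 2 - σ) - 2 =
            σ - (Module.finrank ℝ V / 2 : ℝ) - (2 : ℕ) by push_cast; ring,
          Real.rpow_sub_natCast ht0.ne', Real.rpow_sub ht0, div_div]
        congr 1
        field_simp
    _ = _ := by
        rw [integral_complex_ofReal, integral_const_mul, integral_const_mul,
          integral_Ioi_one_rpow_mul_exp_div]

end FourierLaplace

namespace IsRadialCutoff

variable {χ : ℝ → ℝ}

theorem exists_comp_sqrt_eq_one (hχ : IsRadialCutoff χ) :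
    ∃ δ : ℝ, 0 < δ ∧ ∀ x < δ, χ (√x) = 1 := by
  obtain ⟨ε, hε, hone⟩ := hχ.eq_one_near_zero
  exact ⟨ε ^ 2, by positivity, fun x hx => hone _ (Real.sqrt_nonneg x) ((Real.sqrt_lt' hε).2 hx)⟩

theorem comp_sqrt_eventually_eq_zero (hχ : IsRadialCutoff χ) : ∀ᶠ x in atTop, χ (√x) = 0 := by
  obtain ⟨R, hR⟩ := hχ.compact_support
  filter_upwards [eventually_ge_atTop (R ^ 2)] with x hx using
    hR _ (Real.sqrt_nonneg x) (Real.le_sqrt_of_sq_le hx)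

theorem contDiff_comp_sqrt (hχ : IsRadialCutoff χ) : ContDiff ℝ ∞ fun x => χ (√x) := by
  obtain ⟨δ, hδ, hone⟩ := hχ.exists_comp_sqrt_eq_one
  refine contDiff_iff_contDiffAt.2 fun x => ?_
  rcases lt_or_ge x δ with hx | hx
  · refine (contDiffAt_const (c := (1 : ℝ))).congr_of_eventuallyEq ?_
    filter_upwards [Iio_mem_nhds hx] with y hy using hone y hy
  · have hx0 : 0 < x := hδ.trans_le hx
    exact (hχ.smooth.contDiffAt (Ici_mem_nhds (Real.sqrt_pos.2 hx0))).comp x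
      (Real.contDiffAt_sqrt hx0.ne')

end IsRadialCutoff

section QuadKernel

open Bornology

variable {V : Type*} [NormedAddCommGroup V] [InnerProductSpace ℝ V]

theorem hasTemperateGrowth_inner_apply_self (A : V →L[ℝ] V) :
    (fun y : V => ⟪A y, y⟫_ℝ).HasTemperateGrowth :=
  (innerSL ℝ).bilinear_hasTemperateGrowth A.hasTemperateGrowth .id

theorem exists_schwartz_quadratic_mul_radial (A : V →L[ℝ] V) {c : ℝ} (hc : 0 < c) :
    ∃ T : 𝓢(ℝ, ℝ) →L[ℝ] 𝓢(V, ℂ), ∀ φ y, T φ y = ((⟪A y, y⟫_ℝ * φ (c * ‖y‖ ^ 2) : ℝ) : ℂ) := by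
  have hsq : (fun y : V => c * ‖y‖ ^ 2).HasTemperateGrowth :=
    (Function.HasTemperateGrowth.const c).mul (Function.hasTemperateGrowth_norm_sq V)
  have hproper : ∀ y : V, ‖y‖ ≤ (1 + c⁻¹) * (1 + ‖c * ‖y‖ ^ 2‖) ^ 1 := fun y => by
    have : 0 < c⁻¹ := inv_pos.2 hc
    rw [pow_one, Real.norm_of_nonneg (by positivity)]
    calc ‖y‖ ≤ 1 + ‖y‖ ^ 2 := by nlinarith [sq_nonneg (‖y‖ - 1)]
      _ ≤ 1 + ‖y‖ ^ 2 + (c⁻¹ + c * ‖y‖ ^ 2) := le_add_of_nonneg_right (by positivity)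
      _ = (1 + c⁻¹) * (1 + c * ‖y‖ ^ 2) := by
        field_simp
        ring
  refine ⟨(SchwartzMap.postcompCLM Complex.ofRealCLM).comp
    ((SchwartzMap.smulLeftCLM ℝ fun y : V => ⟪A y, y⟫_ℝ).comp
      (SchwartzMap.compCLM ℝ hsq ⟨1, 1 + c⁻¹, hproper⟩)), fun φ y => ?_⟩
  simp [SchwartzMap.smulLeftCLM_apply_apply (hasTemperateGrowth_inner_apply_self A)]

/-- The cut-off homogeneous kernel `⟪A y, y⟫ |y|^(s-2) χ(|y|)` of degree `s`. It vanishes at the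
origin for every `s`. -/
noncomputable def quadKernel (A : V →L[ℝ] V) (χ : ℝ → ℝ) (s : ℝ) (y : V) : ℝ :=
  ⟪A y, y⟫_ℝ * ‖y‖ ^ (s - 2) * χ ‖y‖

theorem exists_schwartz_family_quadKernel {ι : Type*} {χ : ℝ → ℝ} (hχ : IsRadialCutoff χ)
    (A : V →L[ℝ] V) {s : ι → ℝ} {a b : ℝ} (hs : ∀ i, s i ∈ Icc a b) :
    ∃ Φ : ι → 𝓢(V, ℂ), IsVonNBounded ℝ (range Φ) ∧ ∀ i y, ((quadKernel A χ (s i) y : ℝ) : ℂ) =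
      (((Real.Gamma (1 - s i / 2))⁻¹ : ℝ) : ℂ) *
        ((⟪A y, y⟫_ℝ * laplaceOn (Ioi 1) (-(s i / 2)) (‖y‖ ^ 2) : ℝ) : ℂ) + Φ i y := by
  obtain ⟨δ, hδ, hone⟩ := hχ.exists_comp_sqrt_eq_one
  obtain ⟨Φ, hΦ, hΦ_apply⟩ := exists_schwartz_family_rpow_sub_laplaceOn hχ.contDiff_comp_sqrt hδ
    hone hχ.comp_sqrt_eventually_eq_zero (σ := fun i => -(s i / 2)) (A := -(b / 2)) (B := -(a / 2))
    fun i => ⟨by linarith [(hs i).2], by linarith [(hs i).1]⟩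
  obtain ⟨T, hT⟩ := exists_schwartz_quadratic_mul_radial A one_pos
  refine ⟨_, isVonNBounded_range_clm_comp T hΦ, fun i y => ?_⟩
  rw [hT, ← Complex.ofReal_mul, ← Complex.ofReal_add, one_mul]
  congr 1
  rcases eq_or_ne y 0 with rfl | hy
  · simp [quadKernel]
  · have hy0 : 0 < ‖y‖ := norm_pos_iff.2 hy
    have hpow : ‖y‖ ^ (s i - 2) = (‖y‖ ^ 2) ^ (-(-(s i / 2)) - 1) := by
      rw [← Real.rpow_natCast, ← Real.rpow_mul hy0.le]
      congr 1
      push_cast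
      ring
    have h := hΦ_apply i (‖y‖ ^ 2) (by positivity)
    rw [Real.sqrt_sq hy0.le, ← hpow, neg_add_eq_sub] at h
    rw [quadKernel]
    linear_combination ⟪A y, y⟫_ℝ * h

variable [FiniteDimensional ℝ V] [MeasurableSpace V] [BorelSpace V]

theorem integrable_quadKernel {χ : ℝ → ℝ} (hχ : IsRadialCutoff χ) (A : V →L[ℝ] V) {s : ℝ}
    (hs : -(Module.finrank ℝ V : ℝ) < s) : Integrable (quadKernel A χ s) := by
  obtain ⟨Φ, -, hΦ⟩ := exists_schwartz_family_quadKernel hχ A (s := fun _ : Unit => s)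
    fun _ => ⟨le_rfl, le_rfl⟩
  have h : Integrable fun y : V => ((quadKernel A χ s y : ℝ) : ℂ) := by
    simp only [hΦ ()]
    exact ((integrable_quadratic_mul_laplaceOn A (by linarith)).ofReal.const_mul _).add
      (Φ ()).integrable
  exact h.re

/-- The constant `c` for which `c ⟪A ξ, ξ⟫ / |ξ|^(s+d+2)` is the Fourier transform of
`⟪A y, y⟫ |y|^(s-2)` on a `d`-dimensional space, for trace-free `A`. At the poles of
`Γ(1 - s/2)`, that is for `s = 2, 4, …`, Mathlib's `Γ = 0` gives `Γ⁻¹ = 0`, which is the value of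
the entire function `1/Γ`. -/
noncomputable def quadKernelConst (d s : ℝ) : ℝ :=
  -(Real.pi ^ (d / 2) * 2 ^ (s + d) * Real.Gamma ((s + d) / 2 + 1) * (Real.Gamma (1 - s / 2))⁻¹)

/-- The Fourier transform of `quadKernel A χ s` minus its leading term at infinity. -/
noncomputable def quadRemainder (A : V →L[ℝ] V) (χ : ℝ → ℝ) (s : ℝ) (ξ : V) : ℂ :=
  angularFourier (fun y => ((quadKernel A χ s y : ℝ) : ℂ)) ξ -
    ((quadKernelConst (Module.finrank ℝ V) s *
      (⟪A ξ, ξ⟫_ℝ / ‖ξ‖ ^ (s + Module.finrank ℝ V + 2)) : ℝ) : ℂ)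

theorem inv_Gamma_mul_laplaceOn_Ioo_eq {d s r : ℝ} (hs : -d < s) (hr : 0 < r) :
    -(Real.pi ^ (d / 2) / 4) * (Real.Gamma (1 - s / 2))⁻¹ *
        laplaceOn (Ioo 0 1) ((s + d) / 2) (1 / 4 * r ^ 2) =
      quadKernelConst d s / r ^ (s + d + 2) + Real.pi ^ (d / 2) / 4 * (Real.Gamma (1 - s / 2))⁻¹ *
        laplaceOn (Ioi 1) ((s + d) / 2) (1 / 4 * r ^ 2) := by
  have hsplit := laplaceOn_Ioo_add_laplaceOn_Ioi (σ := (s + d) / 2) (x := 1 / 4 * r ^ 2)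
    (by linarith) (by positivity)
  have hpow : (1 / 4 * r ^ 2) ^ (-((s + d) / 2) - 1) = 4 * 2 ^ (s + d) * (r ^ (s + d + 2))⁻¹ := by
    rw [show 1 / 4 * r ^ 2 = (r / 2) ^ (2 : ℝ) by rw [Real.rpow_two]; ring,
      ← Real.rpow_mul (by positivity), show 2 * (-((s + d) / 2) - 1) = -(s + d + 2) by ring,
      Real.rpow_neg (by positivity), Real.div_rpow hr.le zero_le_two, inv_div,
      Real.rpow_add two_pos, Real.rpow_two]
    ring
  rw [hpow] at hsplit
  rw [quadKernelConst]
  linear_combination -(Real.pi ^ (d / 2) / 4) * (Real.Gamma (1 - s / 2))⁻¹ * hsplit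

theorem angularFourier_add {f g : V → ℂ} (hf : Integrable f) (hg : Integrable g) (ξ : V) :
    angularFourier (fun y => f y + g y) ξ = angularFourier f ξ + angularFourier g ξ := by
  have hint : ∀ {h : V → ℂ}, Integrable h →
      Integrable fun y => Complex.exp (-Complex.I * ((⟪y, ξ⟫_ℝ : ℝ) : ℂ)) * h y := fun hh =>
    hh.bdd_mul (c := 1) (by fun_prop) (Eventually.of_forall fun y =>
      (norm_exp_neg_I_mul_ofReal _).le)
  simp only [angularFourier, mul_add]
  exact integral_add (hint hf) (hint hg)

theorem exists_schwartz_family_quadRemainder {ι : Type*} {χ : ℝ → ℝ} (hχ : IsRadialCutoff χ)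
    {A : V →L[ℝ] V} (hA : LinearMap.trace ℝ V A = 0) {s : ι → ℝ} {a b : ℝ}
    (ha : -(Module.finrank ℝ V : ℝ) < a) (hs : ∀ i, s i ∈ Icc a b) :
    ∃ Φ : ι → 𝓢(V, ℂ), IsVonNBounded ℝ (range Φ) ∧ ∀ i, ∀ ξ ≠ 0,
      quadRemainder A χ (s i) ξ = ((Real.pi ^ (Module.finrank ℝ V / 2 : ℝ) / 4 *
        (Real.Gamma (1 - s i / 2))⁻¹ * (⟪A ξ, ξ⟫_ℝ *
          laplaceOn (Ioi 1) ((s i + Module.finrank ℝ V) / 2) (1 / 4 * ‖ξ‖ ^ 2)) : ℝ) : ℂ) +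
        Φ i ξ := by
  obtain ⟨Φ, hΦ, hΦ_apply⟩ := exists_schwartz_family_quadKernel hχ A hs
  obtain ⟨T, hT⟩ := exists_schwartz_angularFourier (V := V)
  refine ⟨_, isVonNBounded_range_clm_comp T hΦ, fun i ξ hξ => ?_⟩
  have hsi : -(Module.finrank ℝ V : ℝ) < s i := ha.trans_le (hs i).1
  have hFourier : angularFourier (fun y => ((quadKernel A χ (s i) y : ℝ) : ℂ)) ξ =
      (((Real.Gamma (1 - s i / 2))⁻¹ : ℝ) : ℂ) *
        ((-(Real.pi ^ (Module.finrank ℝ V / 2 : ℝ) / 4) * (⟪A ξ, ξ⟫_ℝ *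
          laplaceOn (Ioo 0 1) ((s i + Module.finrank ℝ V) / 2) (1 / 4 * ‖ξ‖ ^ 2)) : ℝ) : ℂ) +
      T (Φ i) ξ := by
    have hσ : -(s i / 2) < (Module.finrank ℝ V / 2 : ℝ) := by linarith
    have hint : Integrable fun y : V =>
        ((⟪A y, y⟫_ℝ * laplaceOn (Ioi 1) (-(s i / 2)) (‖y‖ ^ 2) : ℝ) : ℂ) :=
      (integrable_quadratic_mul_laplaceOn A hσ).ofReal
    simp only [hΦ_apply]
    rw [angularFourier_add (hint.const_mul _) (Φ i).integrable, angularFourier_const_mul,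
      angularFourier_quadratic_mul_laplaceOn hA hσ, hT, sub_neg_eq_add, ← add_div, add_comm (s i),
      one_div_mul_eq_div]
  rw [quadRemainder, hFourier, add_sub_right_comm, ← Complex.ofReal_mul, ← Complex.ofReal_sub]
  congr 2
  linear_combination ⟪A ξ, ξ⟫_ℝ * inv_Gamma_mul_laplaceOn_Ioo_eq hsi (norm_pos_iff.2 hξ)

theorem exists_schwartz_family_eq_quadRemainder {ι : Type*} {χ : ℝ → ℝ} (hχ : IsRadialCutoff χ)
    {A : V →L[ℝ] V} (hA : LinearMap.trace ℝ V A = 0) {s : ι → ℝ} {a b r : ℝ}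
    (ha : -(Module.finrank ℝ V : ℝ) < a) (hs : ∀ i, s i ∈ Icc a b) (hr : 0 < r) :
    ∃ Ψ : ι → 𝓢(V, ℂ), IsVonNBounded ℝ (range Ψ) ∧ ∀ i, ∀ ξ : V, r < ‖ξ‖ →
      quadRemainder A χ (s i) ξ = Ψ i ξ := by
  obtain ⟨Φ, hΦ, hΦ_apply⟩ := exists_schwartz_family_quadRemainder hχ hA ha hs
  obtain ⟨M, hM⟩ := exists_abs_inv_Gamma_le (u := fun i => 1 - s i / 2) (A := 1 - b / 2)
    (B := 1 - a / 2) fun i => ⟨by linarith [(hs i).2], by linarith [(hs i).1]⟩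
  let θ : ℝ → ℝ := fun x => Real.smoothTransition (8 / r ^ 2 * x - 1)
  have hθ_one : ∀ x, r ^ 2 / 4 ≤ x → θ x = 1 := fun x hx =>
    Real.smoothTransition.one_of_one_le <| by
      rw [le_sub_iff_add_le, div_mul_eq_mul_div, le_div_iff₀ (by positivity)]
      linarith
  obtain ⟨Λ, hΛ, hΛ_apply⟩ := exists_schwartz_family_cutoff_mul_laplaceOn_Ioi_one (θ := θ)
    (Real.smoothTransition.contDiff.comp ((contDiff_const.mul contDiff_id).sub contDiff_const))
    (δ := r ^ 2 / 8) (by positivity)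
    (fun x hx => Real.smoothTransition.zero_of_nonpos <| by
      rw [sub_nonpos, div_mul_eq_mul_div, div_le_one (by positivity)]
      linarith) ((eventually_ge_atTop (r ^ 2 / 4)).mono hθ_one)
    (σ := fun i => (s i + Module.finrank ℝ V) / 2) (B := (b + Module.finrank ℝ V) / 2)
    fun i => by linarith [(hs i).2]
  obtain ⟨T, hT⟩ := exists_schwartz_quadratic_mul_radial A (c := 1 / 4) (by norm_num)
  have hcoeff : ∀ i, |Real.pi ^ (Module.finrank ℝ V / 2 : ℝ) / 4 * (Real.Gamma (1 - s i / 2))⁻¹| ≤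
      Real.pi ^ (Module.finrank ℝ V / 2 : ℝ) / 4 * M := fun i => by
    rw [abs_mul, abs_of_pos (by positivity)]
    exact mul_le_mul_of_nonneg_left (hM i) (by positivity)
  refine ⟨_, isVonNBounded_range_add (isVonNBounded_range_smul hcoeff
    (isVonNBounded_range_clm_comp T hΛ)) hΦ, fun i ξ hξ => ?_⟩
  rw [hΦ_apply i ξ (norm_pos_iff.1 (hr.trans hξ)), add_apply, smul_apply, hT, hΛ_apply,
    hθ_one _ (by nlinarith), one_mul, Complex.real_smul, ← Complex.ofReal_mul]

theorem contDiffOn_quadRemainder {χ : ℝ → ℝ} (hχ : IsRadialCutoff χ) {A : V →L[ℝ] V}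
    (hA : LinearMap.trace ℝ V A = 0) {s : ℝ} (hs : -(Module.finrank ℝ V : ℝ) < s) :
    ContDiffOn ℝ ∞ (quadRemainder A χ s) {ξ | ξ ≠ 0} := by
  intro ξ hξ
  obtain ⟨Ψ, -, hΨ⟩ := exists_schwartz_family_eq_quadRemainder hχ hA (s := fun _ : Unit => s) hs
    (fun _ => ⟨le_rfl, le_rfl⟩) (half_pos (norm_pos_iff.2 hξ))
  have hnear : ∀ᶠ η in 𝓝 ξ, ‖ξ‖ / 2 < ‖η‖ :=
    continuous_norm.continuousAt.eventually_const_lt (half_lt_self (norm_pos_iff.2 hξ))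
  exact (((Ψ ()).smooth ⊤).contDiffAt.congr_of_eventuallyEq (hnear.mono (hΨ ()))).contDiffWithinAt

theorem exists_norm_iteratedFDeriv_quadRemainder_le {χ : ℝ → ℝ} (hχ : IsRadialCutoff χ)
    {A : V →L[ℝ] V} (hA : LinearMap.trace ℝ V A = 0) {a : ℝ}
    (ha : -(Module.finrank ℝ V : ℝ) < a) (b : ℝ) {r : ℝ} (hr : 0 < r) (k N : ℕ) :
    ∃ C, ∀ s ∈ Icc a b, ∀ ξ : V, r < ‖ξ‖ →
      ‖iteratedFDeriv ℝ k (quadRemainder A χ s) ξ‖ ≤ C / ‖ξ‖ ^ N := by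
  obtain ⟨Ψ, hΨ, hΨ_apply⟩ := exists_schwartz_family_eq_quadRemainder hχ hA
    (s := fun s : Icc a b => (s : ℝ)) ha Subtype.property hr
  obtain ⟨C, hC⟩ := isVonNBounded_range_schwartz_iff.1 hΨ N k
  refine ⟨C, fun s hs ξ hξ => ?_⟩
  have hnear : ∀ᶠ η in 𝓝 ξ, r < ‖η‖ := continuous_norm.continuousAt.eventually_const_lt hξ
  have heq : quadRemainder A χ s =ᶠ[𝓝 ξ] Ψ ⟨s, hs⟩ := hnear.mono (hΨ_apply ⟨s, hs⟩)
  rw [(heq.iteratedFDeriv ℝ k).eq_of_nhds, le_div_iff₀' (pow_pos (hr.trans hξ) N)]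
  exact (SchwartzMap.le_seminorm ℝ N k _ ξ).trans (hC ⟨s, hs⟩)

theorem propositionC1_general {χ : ℝ → ℝ} (hχ : IsRadialCutoff χ) {A : V →L[ℝ] V}
    (hA : LinearMap.trace ℝ V A = 0) :
    (∀ s : ℝ, -(Module.finrank ℝ V : ℝ) < s →
      Integrable (quadKernel A χ s) ∧ ContDiffOn ℝ ∞ (quadRemainder A χ s) {ξ | ξ ≠ 0}) ∧
    ∀ a b r : ℝ, -(Module.finrank ℝ V : ℝ) < a → 0 < r → ∀ k N : ℕ, ∃ C : ℝ,
      ∀ s ∈ Icc a b, ∀ ξ : V, r < ‖ξ‖ →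
        ‖iteratedFDeriv ℝ k (quadRemainder A χ s) ξ‖ ≤ C / ‖ξ‖ ^ N :=
  ⟨fun _ hs => ⟨integrable_quadKernel hχ A hs, contDiffOn_quadRemainder hχ hA hs⟩,
    fun _ b _ ha hr => exists_norm_iteratedFDeriv_quadRemainder_le hχ hA ha b hr⟩

end QuadKernel

theorem inv_Gamma_one_sub {x : ℝ} (hx : 0 < x) :
    (Real.Gamma (1 - x))⁻¹ = Real.Gamma x * Real.sin (Real.pi * x) / Real.pi := by
  have h := congrArg Inv.inv (Real.Gamma_mul_Gamma_one_sub x)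
  rw [mul_inv, inv_div, inv_mul_eq_iff_eq_mul₀ (Real.Gamma_pos_of_pos hx).ne'] at h
  rw [h, mul_div_assoc]

theorem mul_inv_Gamma_one_sub_half {s : ℝ} (hs : -4 < s) :
    s * (s + 2) * (Real.Gamma (1 - s / 2))⁻¹ =
      4 * (Real.Gamma (s / 2 + 2) * Real.sin (Real.pi * s / 2) / Real.pi) := by
  have hreflect := inv_Gamma_one_sub (x := s / 2 + 2) (by linarith)
  have hsin : Real.sin (Real.pi * (s / 2 + 2)) = Real.sin (Real.pi * s / 2) := by
    rw [show Real.pi * (s / 2 + 2) = Real.pi * s / 2 + 2 * Real.pi by ring, Real.sin_add_two_pi]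
  have hshift := mul_inv_Gamma_add_one (-(s / 2))
  have hshift' := mul_inv_Gamma_add_one (-(s / 2) - 1)
  rw [neg_add_eq_sub] at hshift
  rw [sub_add_cancel, ← hshift, show -(s / 2) - 1 = 1 - (s / 2 + 2) by ring, hreflect, hsin]
    at hshift'
  linear_combination 4 * hshift'

theorem pi_rpow_three_halves : Real.pi ^ (3 / 2 : ℝ) = Real.pi * √Real.pi := by
  rw [show (3 / 2 : ℝ) = 1 + 1 / 2 by norm_num, Real.rpow_add Real.pi_pos, Real.rpow_one,
    ← Real.sqrt_eq_rpow]

theorem Gamma_three_halves : Real.Gamma (3 / 2) = √Real.pi / 2 := by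
  rw [show (3 / 2 : ℝ) = 1 / 2 + 1 by norm_num, Real.Gamma_add_one (by norm_num),
    Real.Gamma_one_half_eq, one_div_mul_eq_div]

theorem mul_quadKernelConst_three {s : ℝ} (hs : -4 < s) :
    s * (s + 2) * quadKernelConst 3 s =
      -(4 * Real.pi * Real.Gamma (s + 4) * Real.sin (Real.pi * s / 2)) := by
  have hdup := Real.Gamma_mul_Gamma_add_half (s / 2 + 2)
  rw [show s / 2 + 2 + 1 / 2 = (s + 3) / 2 + 1 by ring, show 2 * (s / 2 + 2) = s + 4 by ring,
    show 1 - (s + 4) = -(s + 3) by ring, Real.rpow_neg zero_le_two, mul_right_comm,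
    ← div_eq_mul_inv, eq_div_iff (by positivity)] at hdup
  calc s * (s + 2) * quadKernelConst 3 s
      = -(Real.pi * √Real.pi * 2 ^ (s + 3) * Real.Gamma ((s + 3) / 2 + 1) *
          (s * (s + 2) * (Real.Gamma (1 - s / 2))⁻¹)) := by
        rw [quadKernelConst, pi_rpow_three_halves]
        ring
    _ = -(4 * √Real.pi * Real.sin (Real.pi * s / 2) *
          (Real.Gamma (s / 2 + 2) * Real.Gamma ((s + 3) / 2 + 1) * 2 ^ (s + 3))) := by
        rw [mul_inv_Gamma_one_sub_half hs]
        field_simp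
    _ = -(4 * (√Real.pi * √Real.pi) * Real.Gamma (s + 4) * Real.sin (Real.pi * s / 2)) := by
        rw [hdup]
        ring
    _ = _ := by rw [Real.mul_self_sqrt Real.pi_pos.le]

theorem quadKernelConst_three_zero : quadKernelConst 3 0 = -6 * Real.pi ^ 2 := by
  have hΓ : Real.Gamma ((0 + 3) / 2 + 1) = 3 / 2 * (√Real.pi / 2) := by
    rw [zero_add, Real.Gamma_add_one (by norm_num), Gamma_three_halves]
  have hpow : (2 : ℝ) ^ (0 + 3 : ℝ) = 8 := by norm_num
  rw [quadKernelConst, pi_rpow_three_halves, hpow, hΓ, zero_div, sub_zero, Real.Gamma_one]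
  linear_combination -6 * Real.pi * Real.mul_self_sqrt Real.pi_pos.le

theorem quadKernelConst_three_neg_two : quadKernelConst 3 (-2) = -Real.pi ^ 2 := by
  have hpow : (2 : ℝ) ^ (-2 + 3 : ℝ) = 2 := by norm_num
  rw [quadKernelConst, pi_rpow_three_halves, hpow, show ((-2 : ℝ) + 3) / 2 + 1 = 3 / 2 by norm_num,
    Gamma_three_halves, show 1 - (-2 : ℝ) / 2 = 2 by norm_num, Real.Gamma_two]
  linear_combination -Real.pi * Real.mul_self_sqrt Real.pi_pos.le

theorem refConst_eq_quadKernelConst {s : ℝ} (hs : -3 < s) : refConst s = quadKernelConst 3 s := by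
  unfold refConst
  split_ifs with h0 h2
  · rw [h0, quadKernelConst_three_zero]
  · rw [h2, quadKernelConst_three_neg_two]
  · have hs2 : s + 2 ≠ 0 := fun h => h2 (by linarith)
    rw [← mul_right_inj' (mul_ne_zero h0 hs2), mul_quadKernelConst_three (by linarith)]
    field_simp

/-- The trace-free operator whose quadratic form is `tracelessQuad α β`. It is not symmetric unless
`α = β`. -/
noncomputable def tracelessOperator (α β : Fin 3) :
    EuclideanSpace ℝ (Fin 3) →L[ℝ] EuclideanSpace ℝ (Fin 3) :=
  (EuclideanSpace.proj α : EuclideanSpace ℝ (Fin 3) →L[ℝ] ℝ).smulRight (EuclideanSpace.single β 1) -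
    ((1 / 3) * (if α = β then 1 else 0) : ℝ) • ContinuousLinearMap.id ℝ _

theorem trace_tracelessOperator (α β : Fin 3) :
    LinearMap.trace ℝ _ (tracelessOperator α β : EuclideanSpace ℝ (Fin 3) →ₗ[ℝ] _) = 0 := by
  have hdyad : LinearMap.trace ℝ _
      (((EuclideanSpace.proj α : EuclideanSpace ℝ (Fin 3) →L[ℝ] ℝ) :
        EuclideanSpace ℝ (Fin 3) →ₗ[ℝ] ℝ).smulRight (EuclideanSpace.single β (1 : ℝ))) =
      if α = β then 1 else 0 := by
    rw [LinearMap.trace_smulRight]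
    simp
  rw [tracelessOperator, ContinuousLinearMap.toLinearMap_sub, ContinuousLinearMap.toLinearMap_smul,
    ContinuousLinearMap.coe_smulRight, map_sub, hdyad, map_smul, ContinuousLinearMap.coe_id,
    LinearMap.trace_id, finrank_euclideanSpace_fin]
  split_ifs <;> norm_num

theorem inner_tracelessOperator_apply_self (α β : Fin 3) (y : EuclideanSpace ℝ (Fin 3)) :
    ⟪tracelessOperator α β y, y⟫_ℝ = tracelessQuad α β y := by
  simp only [tracelessOperator, tracelessQuad, sub_apply,
    ContinuousLinearMap.smulRight_apply, smul_apply,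
    ContinuousLinearMap.id_apply, inner_sub_left, real_inner_smul_left, real_inner_self_eq_norm_sq,
    EuclideanSpace.inner_single_left, PiLp.proj_apply, map_one, one_mul]

theorem refKernel_eq_quadKernel (χ : ℝ → ℝ) (s : ℝ) (α β : Fin 3) :
    refKernel χ s α β = quadKernel (tracelessOperator α β) χ s := by
  ext y
  rw [refKernel, quadKernel, inner_tracelessOperator_apply_self]
  split_ifs with hy
  · simp [hy, tracelessQuad]
  · rw [← neg_sub 2 s, Real.rpow_neg (norm_nonneg y), ← div_eq_mul_inv]

theorem refRemainder_eq_quadRemainder (χ : ℝ → ℝ) {s : ℝ} (hs : -3 < s) (α β : Fin 3) :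
    refRemainder χ s α β = quadRemainder (tracelessOperator α β) χ s := by
  ext ξ
  rw [refRemainder, refKernelHat, quadRemainder, angularFourier, refConst_eq_quadKernelConst hs,
    refKernel_eq_quadKernel, inner_tracelessOperator_apply_self, finrank_euclideanSpace_fin,
    Nat.cast_ofNat, add_assoc s, show (3 : ℝ) + 2 = 5 by norm_num, add_comm s]

theorem propositionC1 (χ : ℝ → ℝ) (hχ : IsRadialCutoff χ) (α β : Fin 3) :
    (∀ s : ℝ, -3 < s →
      MeasureTheory.Integrable (refKernel χ s α β) ∧
      ContDiffOn ℝ ∞ (refRemainder χ s α β) {ξ | ξ ≠ 0}) ∧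
    (∀ a b : ℝ, -3 < a → a ≤ b → ∀ k N : ℕ, ∃ C R : ℝ, 0 < R ∧
      ∀ s ∈ Set.Icc a b, ∀ ξ : EuclideanSpace ℝ (Fin 3), R ≤ ‖ξ‖ →
        ‖iteratedFDeriv ℝ k (refRemainder χ s α β) ξ‖ ≤ C / ‖ξ‖ ^ N) := by
  have h := propositionC1_general hχ (trace_tracelessOperator α β)
  rw [finrank_euclideanSpace_fin, Nat.cast_ofNat] at h
  refine ⟨fun s hs => ?_, fun a b ha _ k N => ?_⟩
  · rw [refKernel_eq_quadKernel, refRemainder_eq_quadRemainder χ hs]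
    exact h.1 s hs
  · obtain ⟨C, hC⟩ := h.2 a b 1 ha one_pos k N
    refine ⟨C, 2, two_pos, fun s hs ξ hξ => ?_⟩
    rw [refRemainder_eq_quadRemainder χ (ha.trans_le hs.1)]
    exact hC s hs ξ (one_lt_two.trans_le hξ)
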